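/- Let $S$ be a countable set and let $p(x,y)$, $x,y\in S$, be the transition probabilities of a Markov chain on $S$ (so $p(x,y)\ge 0$ and $\sum_y p(x,y)=1$ for all $x$) with $\sup_{y}\sum_x p(x,y)<\infty$. Let $\eta_t$ be the exclusion process on $\{0,1\}^S$ with kernel $p$, i.e. the Feller process whose generator is given, on functions $f$ of finitely many coordinates, by $$\Omega f(\eta)=\sum_{x,y\in S:\ \eta(x)=1,\ \eta(y)=0}p(x,y)\,\bigl[f(\eta_{x\to y})-f(\eta)\bigr],$$ where $\eta_{x\to y}$ is obtained from $\eta$ by moving the particle at $x$ to $y$. Let $\alpha:S\to(0,1)$, and let $\nu_\alpha$ be the product measure on $\{0,1\}^S$ with marginals $\nu_\alpha\{\eta:\eta(x)=1\}=\alpha(x)$. Let $\alpha_1,\alpha_2,\dots$ be the distinct values of $\alpha$, let $\pi_i=\alpha_i/(1-\alpha_i)$, and let $C_i=\{x\in S:\alpha(x)=\alpha_i\}$. Then $\nu_\alpha$ is stationary for $\eta_t$ if and only if both of the following hold: (a) $\sum_{y\in C_i}p(x,y)=\sum_{y\in C_i}p(y,x)$ for all $x\in C_i$ and all $i$; (b)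 $\pi_i\,p(x,y)=\pi_j\,p(y,x)$ for all $x\in C_i$, $y\in C_j$ and all $i\ne j$. -/

import Mathlib

open MeasureTheory ProbabilityTheory Filter Topology
open scoped NNReal

namespace Exclusion

/-- Configurations `η ∈ {0,1}^S`: `η x = true` means that the site `x` is occupied.
It carries the product topology and the product σ-algebra. -/
abbrev Config (S : Type*) : Type _ := S → Bool

open Classical in
/-- The configuration `η` after the particle at `x` has moved to `y`. -/
noncomputable def move {S : Type*} (η : Config S) (x y : S) : Config S :=
  Function.update (Function.update η x false) y true

/-- `p` is a stochastic matrix on `S`. -/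
def IsStochastic {S : Type*} (p : S → S → ℝ) : Prop :=
  (∀ x y, 0 ≤ p x y) ∧ ∀ x, HasSum (fun y => p x y) 1

/-- The column sums of `p` are bounded: `sup_y ∑_x p(x, y) < ∞`. -/
def BoundedColumnSums {S : Type*} (p : S → S → ℝ) : Prop :=
  ∃ M : ℝ, ∀ (y : S) (F : Finset S), ∑ x ∈ F, p x y ≤ M

/-- `f` depends on finitely many coordinates only. -/
def IsCylinder {S : Type*} (f : Config S → ℝ) : Prop :=
  ∃ A : Finset S, DependsOn f (A : Set S)

/-- The generator of the exclusion process on cylinder functions: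
`Ω f(η) = ∑_{x, y : η(x) = 1, η(y) = 0} p(x, y) [f(η_{x → y}) - f(η)]`. -/
noncomputable def generator {S : Type*} (p : S → S → ℝ) (f : Config S → ℝ) (η : Config S) : ℝ :=
  ∑' xy : S × S, if η xy.1 = true ∧ η xy.2 = false then
    p xy.1 xy.2 * (f (move η xy.1 xy.2) - f η) else 0

/-- `P t η` is the law at time `t` of the exclusion process with kernel `p` started from `η`:
`P` is the transition function of a Feller process on `{0,1}^S` whose generator is
given on cylinder functions `f` by `generator p f`, that is,
`(P_t f - f) / t → Ω f` uniformly on `{0,1}^S` as `t ↓ 0`. -/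
structure IsExclusionProcess {S : Type*} (p : S → S → ℝ)
    (P : ℝ≥0 → Kernel (Config S) (Config S)) : Prop where
  markov : ∀ t, IsMarkovKernel (P t)
  zero : P 0 = Kernel.id
  chapman_kolmogorov : ∀ s t, P (s + t) = P t ∘ₖ P s
  feller : ∀ t (f : Config S → ℝ), Continuous f → Continuous fun η => ∫ ζ, f ζ ∂(P t η)
  generator_eq : ∀ f : Config S → ℝ, IsCylinder f →
    TendstoUniformly (fun (t : ℝ≥0) η => ((∫ ζ, f ζ ∂(P t η)) - f η) / (t : ℝ))
      (generator p f) (𝓝[>] 0)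

/-- `μ` is stationary for the process with transition function `P`: `μ P_t = μ` for all `t`. -/
def IsStationary {X : Type*} [MeasurableSpace X] (P : ℝ≥0 → Kernel X X) (μ : Measure X) : Prop :=
  ∀ t, (P t).Invariant μ

/-- The product measure `ν_α` on `{0,1}^S` with `ν_α {η : η(x) = 1} = α(x)`. -/
noncomputable def productMeasure {S : Type*} (α : S → ℝ) : Measure (Config S) :=
  Measure.infinitePi fun x =>
    ENNReal.ofReal (α x) • Measure.dirac true + ENNReal.ofReal (1 - α x) • Measure.dirac false

/-- The level set `{x ∈ S : α(x) = a}`. -/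
def levelSet {S : Type*} (α : S → ℝ) (a : ℝ) : Set S := {x | α x = a}

end Exclusion

/-!
Write `Ω` for the generator and `ν` for the product measure. The proof has two halves.

**Reduction to the generator** (`IsExclusionProcess.isStationary_iff`). A probability measure is
stationary if and only if it annihilates `Ω f` for every cylinder function `f`. One direction is
differentiation at `t = 0`. The other one expresses that cylinder functions are a core; it is proved
by approximation: keep only a finite set `E` of jumps and run the Euler scheme
`v ↦ v + h Ω_E v` from `f`. The iterates remain functions of a fixed finite set of coordinates, and
their oscillation at a site `z` is at most a constant times `H z`, where `H` is a summable function
not depending on `E` (`exists_isSupersolution`, `HasOscBound.eulerStep`; this is where the bound on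
the column sums enters). Hence `(Ω - Ω_E) v` is uniformly small along the scheme, so that the scheme
stays close to the semigroup, while its integral against the measure is almost constant.

**Mean of the generator under `ν`** (`hasSum_integral_generator`). With
`c(x, y) = p(x, y) α(x) (1 - α(y))`, the integral of `Ω f` is `∑ c(x, y) D(x, y)`, where `D`
(`exchange`) is antisymmetric. The test functions `(η(u) - α(u)) (η(v) - α(v))` and `η(u)` show that
the vanishing of these integrals forces `c(u, v) = c(v, u)` for `α(u) ≠ α(v)`, which is (b), and the
balance of currents at `u`, which given (b) is (a). Conversely, if `α(x) = α(y)`, then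
`c(x, y) D(x, y) = p(x, y) (e(y) - e(x))` with `e` of finite support (`siteCovariance_sub`), and the
sum of these terms vanishes by (a); the other terms cancel in pairs by (b).
-/

namespace Exclusion

variable {S : Type*}

/-! ### Attempted jumps and oscillation bounds -/

open Classical in
/-- The configuration after an attempted jump from `x` to `y`: the particle moves if `x` is occupied
and `y` is empty, and nothing happens otherwise. With it the exclusion constraint disappears from
the sum defining the generator. -/
noncomputable def hop (η : Config S) (x y : S) : Config S :=
  if η x = true ∧ η y = false then move η x y else η

lemma move_apply_of_ne (η : Config S) {x y w : S} (hx : w ≠ x) (hy : w ≠ y) :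
    move η x y w = η w := by
  simp [move, hx, hy]

lemma hop_apply_of_ne (η : Config S) {x y w : S} (hx : w ≠ x) (hy : w ≠ y) :
    hop η x y w = η w := by
  unfold hop
  split_ifs
  · exact move_apply_of_ne η hx hy
  · rfl

lemma move_congr {η ζ : Config S} (x y : S) {w : S} (h : η w = ζ w) :
    move η x y w = move ζ x y w := by
  by_cases hy : w = y
  · simp [move, hy]
  by_cases hx : w = x
  · subst hx; simp [move, hy]
  · simp [move, hx, hy, h]

lemma hop_congr {η ζ : Config S} {x y w : S} (hx : η x = ζ x) (hy : η y = ζ y) (h : η w = ζ w) :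
    hop η x y w = hop ζ x y w := by
  unfold hop
  rw [hx, hy]
  split_ifs
  · exact move_congr x y h
  · exact h

lemma generator_eq_tsum_hop (p : S → S → ℝ) (f : Config S → ℝ) (η : Config S) :
    generator p f η = ∑' xy : S × S, p xy.1 xy.2 * (f (hop η xy.1 xy.2) - f η) := by
  unfold generator hop
  congr 1
  ext xy
  split_ifs <;> simp

/-- Changing `η` at the single site `z` changes `f η` by at most `H z`. -/
def HasOscBound (f : Config S → ℝ) (H : S → ℝ) : Prop :=
  ∀ (η ζ : Config S) (z : S), (∀ w, w ≠ z → η w = ζ w) → |f ζ - f η| ≤ H z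

lemma HasOscBound.abs_sub_le_add {f : Config S → ℝ} {H : S → ℝ} (hf : HasOscBound f H)
    {η ζ : Config S} (x y : S) (h : ∀ w, w ≠ x → w ≠ y → η w = ζ w) :
    |f ζ - f η| ≤ H x + H y := by
  classical
  have h1 : |f (Function.update η x (ζ x)) - f η| ≤ H x :=
    hf _ _ x fun w hw => by simp [hw]
  have h2 : |f ζ - f (Function.update η x (ζ x))| ≤ H y :=
    hf _ _ y fun w hw => by
      by_cases hx : w = x
      · subst hx; simp
      · simp [hx, h w hx hw]
  calc |f ζ - f η| ≤ |f ζ - f (Function.update η x (ζ x))|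
        + |f (Function.update η x (ζ x)) - f η| := abs_sub_le _ _ _
    _ ≤ H x + H y := by linarith

lemma HasOscBound.abs_hop_sub_le {f : Config S → ℝ} {H : S → ℝ} (hf : HasOscBound f H)
    (η : Config S) (x y : S) : |f (hop η x y) - f η| ≤ H x + H y :=
  hf.abs_sub_le_add x y fun _ hx hy => (hop_apply_of_ne η hx hy).symm

lemma HasOscBound.comp_hop {f : Config S → ℝ} {H : S → ℝ} (hf : HasOscBound f H) (x y : S)
    {η ζ : Config S} {z : S} (h : ∀ w, w ≠ z → η w = ζ w) (hx : z ≠ x) (hy : z ≠ y) :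
    |f (hop ζ x y) - f (hop η x y)| ≤ H z :=
  hf _ _ z fun w hw => hop_congr (h x hx.symm) (h y hy.symm) (h w hw)

lemma HasOscBound.comp_hop_of_mem {f : Config S → ℝ} {H : S → ℝ} (hf : HasOscBound f H) (x y : S)
    {η ζ : Config S} {z : S} (h : ∀ w, w ≠ z → η w = ζ w) (hz : z = x ∨ z = y) :
    |f (hop ζ x y) - f (hop η x y)| ≤ H x + H y :=
  hf.abs_sub_le_add x y fun w hx hy => by
    rw [hop_apply_of_ne η hx hy, hop_apply_of_ne ζ hx hy]
    exact h w (by rcases hz with rfl | rfl <;> assumption)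

open Classical in
/-- The configuration equal to `σ` on `A` and empty elsewhere. -/
noncomputable def fillEmpty (A : Finset S) (σ : A → Bool) : Config S :=
  fun x => if h : x ∈ A then σ ⟨x, h⟩ else false

lemma apply_fillEmpty_of_dependsOn {f : Config S → ℝ} {A : Finset S}
    (hf : DependsOn f (A : Set S)) (η : Config S) : f (fillEmpty A fun i => η i) = f η :=
  hf fun x hx => by simp [fillEmpty, Finset.mem_coe.1 hx]

lemma exists_abs_le_of_dependsOn {f : Config S → ℝ} {A : Finset S}
    (hf : DependsOn f (A : Set S)) : ∃ C : ℝ, 0 ≤ C ∧ ∀ η, |f η| ≤ C := by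
  classical
  refine ⟨∑ σ, |f (fillEmpty A σ)|, Finset.sum_nonneg fun _ _ => abs_nonneg _, fun η => ?_⟩
  rw [← apply_fillEmpty_of_dependsOn hf η]
  exact Finset.single_le_sum (f := fun σ => |f (fillEmpty A σ)|) (fun _ _ => abs_nonneg _)
    (Finset.mem_univ _)

lemma hasOscBound_of_dependsOn {f : Config S → ℝ} {A : Finset S} {C : ℝ} {H : S → ℝ}
    (hf : DependsOn f (A : Set S)) (hC : ∀ η, |f η| ≤ C) (hH : ∀ z, 0 ≤ H z)
    (hA : ∀ z ∈ A, 1 ≤ H z) : HasOscBound f fun z => 2 * C * H z := by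
  intro η ζ z h
  have hC0 : 0 ≤ C := (abs_nonneg _).trans (hC η)
  by_cases hz : z ∈ A
  · have h1 := abs_sub (f ζ) (f η)
    have h2 := hC ζ
    have h3 := hC η
    nlinarith [hA z hz]
  · have : f ζ = f η := hf fun x hx => (h x (by rintro rfl; exact hz (by simpa using hx))).symm
    rw [this, sub_self, abs_zero]
    have := hH z
    positivity

lemma measurable_of_dependsOn {f : Config S → ℝ} {A : Finset S}
    (hf : DependsOn f (A : Set S)) : Measurable f := by
  have : f = (fun σ => f (fillEmpty A σ)) ∘ fun η (i : A) => η i := by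
    funext η
    exact (apply_fillEmpty_of_dependsOn hf η).symm
  rw [this]
  exact (measurable_of_countable _).comp (measurable_pi_lambda _ fun i => measurable_pi_apply _)

lemma integrable_of_dependsOn {f : Config S → ℝ} {A : Finset S}
    (hf : DependsOn f (A : Set S)) (μ : Measure (Config S)) [IsFiniteMeasure μ] :
    Integrable f μ := by
  obtain ⟨C, -, hC⟩ := exists_abs_le_of_dependsOn hf
  exact Integrable.of_bound (measurable_of_dependsOn hf).aestronglyMeasurable C
    (Eventually.of_forall hC)

/-! ### Summable superinvariant functions -/

/-- If the column sums of `q` are bounded, there is a summable `H ≥ 1_A` with `q H ≤ K H`: for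
large `K`, take `H = ∑ₖ (q / K)ᵏ 1_A`. -/
lemma exists_summable_superinvariant (q : S → S → ℝ) (hq : ∀ x y, 0 ≤ q x y) (c : ℝ)
    (hc : ∀ (y : S) (F : Finset S), ∑ x ∈ F, q x y ≤ c) (A : Finset S) :
    ∃ (H : S → ℝ) (K : ℝ), 0 ≤ K ∧ (∀ z, 0 ≤ H z) ∧ Summable H ∧ (∀ z ∈ A, 1 ≤ H z) ∧
      ∀ (z : S) (F : Finset S), ∑ y ∈ F, q z y * H y ≤ K * H z := by
  classical
  let d : ℝ := max c 1
  have hd : 0 < d := lt_of_lt_of_le one_pos (le_max_right _ _)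
  let D : ENNReal := ENNReal.ofReal d
  have hD0 : D ≠ 0 := by simpa [D] using hd
  have hDt : D ≠ ⊤ := ENNReal.ofReal_ne_top
  have h2D0 : 2 * D ≠ 0 := by simp [hD0]
  have h2Dt : 2 * D ≠ ⊤ := ENNReal.mul_ne_top (by simp) hDt
  let Q : S → S → ENNReal := fun x y => ENNReal.ofReal (q x y)
  have hcol : ∀ y, ∑' x, Q x y ≤ D := fun y => by
    rw [ENNReal.tsum_eq_iSup_sum]
    refine iSup_le fun F => ?_
    rw [← ENNReal.ofReal_sum_of_nonneg fun x _ => hq x y]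
    exact ENNReal.ofReal_le_ofReal ((hc y F).trans (le_max_left _ _))
  -- `K = 2 * D`; the series is summed in `ENNReal`, where no summability has to be checked
  let T : (S → ENNReal) → S → ENNReal := fun h z => (2 * D)⁻¹ * ∑' y, Q z y * h y
  let g : ℕ → S → ENNReal := fun k => T^[k] (fun z => if z ∈ A then 1 else 0)
  have hg : ∀ k, g (k + 1) = T (g k) := fun k => Function.iterate_succ_apply' _ _ _
  -- one application of `T` at least halves the total mass
  have hT : ∀ h : S → ENNReal, ∑' z, T h z ≤ 2⁻¹ * ∑' y, h y := fun h => by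
    calc ∑' z, T h z = (2 * D)⁻¹ * ∑' z, ∑' y, Q z y * h y := ENNReal.tsum_mul_left
      _ = (2 * D)⁻¹ * ∑' y, (∑' z, Q z y) * h y := by
        rw [ENNReal.tsum_comm]; simp_rw [ENNReal.tsum_mul_right]
      _ ≤ (2 * D)⁻¹ * ∑' y, D * h y := by
        gcongr with y; exact hcol y
      _ = 2⁻¹ * ∑' y, h y := by
        rw [ENNReal.tsum_mul_left, ← mul_assoc, ENNReal.mul_inv (by simp) (by simp), mul_assoc 2⁻¹,
          ENNReal.inv_mul_cancel hD0 hDt, mul_one]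
  have hmass : ∀ k, ∑' z, g k z ≤ 2⁻¹ ^ k * (A.card : ENNReal) := fun k => by
    induction k with
    | zero =>
      have : ∑' z, g 0 z = ∑ z ∈ A, (1 : ENNReal) := by
        rw [tsum_eq_sum (s := A) (fun z hz => by simp [g, hz])]
        exact Finset.sum_congr rfl fun z hz => by simp [g, hz]
      simp [this]
    | succ k ih =>
      rw [hg, pow_succ', mul_assoc]
      exact (hT _).trans (by gcongr)
  let G : S → ENNReal := fun z => ∑' k, g k z
  have hGsum : ∑' z, G z ≠ ⊤ := by
    have : ∑' z, G z ≤ 2 * (A.card : ENNReal) := by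
      calc ∑' z, G z = ∑' k, ∑' z, g k z := ENNReal.tsum_comm
        _ ≤ ∑' k : ℕ, 2⁻¹ ^ k * (A.card : ENNReal) := ENNReal.tsum_le_tsum hmass
        _ = 2 * (A.card : ENNReal) := by
          rw [ENNReal.tsum_mul_right, ENNReal.tsum_geometric, ENNReal.one_sub_inv_two, inv_inv]
    exact ne_top_of_le_ne_top (ENNReal.mul_ne_top (by simp) (by simp)) this
  have hGt : ∀ z, G z ≠ ⊤ := ENNReal.ne_top_of_tsum_ne_top hGsum
  have hGsup : ∀ z, ∑' y, Q z y * G y ≤ 2 * D * G z := fun z => by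
    calc ∑' y, Q z y * G y = ∑' k, ∑' y, Q z y * g k y := by
          simp_rw [G, ← ENNReal.tsum_mul_left]; exact ENNReal.tsum_comm
      _ = ∑' k, 2 * D * g (k + 1) z := by
          congr 1; ext k
          rw [hg, ← mul_assoc, ENNReal.mul_inv_cancel h2D0 h2Dt, one_mul]
      _ = 2 * D * ∑' k, g (k + 1) z := ENNReal.tsum_mul_left
      _ ≤ 2 * D * G z := by
          gcongr
          exact ENNReal.tsum_comp_le_tsum_of_injective (add_left_injective 1) fun k => g k z
  refine ⟨fun z => (G z).toReal, 2 * d, by positivity, fun z => ENNReal.toReal_nonneg,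
    ENNReal.summable_toReal hGsum, fun z hz => ?_, fun z F => ?_⟩
  · have : (1 : ENNReal) ≤ G z := by
      have h0 : g 0 z = 1 := by simp [g, hz]
      exact h0 ▸ ENNReal.le_tsum 0
    simpa using ENNReal.toReal_mono (hGt z) this
  · have h1 : ∑ y ∈ F, Q z y * G y ≤ 2 * D * G z := (ENNReal.sum_le_tsum F).trans (hGsup z)
    have h2 := ENNReal.toReal_mono (ENNReal.mul_ne_top h2Dt (hGt z)) h1
    rw [ENNReal.toReal_sum fun y _ => ENNReal.mul_ne_top ENNReal.ofReal_ne_top (hGt y)] at h2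
    simpa [Q, D, ENNReal.toReal_ofReal (hq _ _), ENNReal.toReal_ofReal hd.le] using h2

/-! ### Euler steps of finitely many jumps -/

/-- The part of the generator coming from the jumps in the finite set `E`. Unlike the full
generator, it maps cylinder functions to cylinder functions. -/
noncomputable def partialGenerator (p : S → S → ℝ) (E : Finset (S × S)) (f : Config S → ℝ)
    (η : Config S) : ℝ :=
  ∑ xy ∈ E, p xy.1 xy.2 * (f (hop η xy.1 xy.2) - f η)

/-- One explicit Euler step of size `h` for `∂ₜ f = L f`, with `L = partialGenerator p E`. -/
noncomputable def eulerStep (p : S → S → ℝ) (E : Finset (S × S)) (h : ℝ) (f : Config S → ℝ)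
    (η : Config S) : ℝ :=
  f η + h * partialGenerator p E f η

lemma eulerStep_eq (p : S → S → ℝ) (E : Finset (S × S)) (h : ℝ) (f : Config S → ℝ)
    (η : Config S) :
    eulerStep p E h f η = (1 - h * ∑ xy ∈ E, p xy.1 xy.2) * f η +
      h * ∑ xy ∈ E, p xy.1 xy.2 * f (hop η xy.1 xy.2) := by
  simp only [eulerStep, partialGenerator, mul_sub, Finset.sum_sub_distrib, ← Finset.sum_mul]
  ring

lemma dependsOn_partialGenerator (p : S → S → ℝ) {E : Finset (S × S)} {f : Config S → ℝ}
    {B : Finset S} (hE : ∀ xy ∈ E, xy.1 ∈ B ∧ xy.2 ∈ B) (hf : DependsOn f (B : Set S)) :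
    DependsOn (partialGenerator p E f) (B : Set S) := by
  intro η ζ h
  refine Finset.sum_congr rfl fun xy hxy => ?_
  rw [hf h, hf (x := hop η xy.1 xy.2) (y := hop ζ xy.1 xy.2) fun w hw =>
    hop_congr (h _ (hE xy hxy).1) (h _ (hE xy hxy).2) (h w hw)]

lemma dependsOn_eulerStep (p : S → S → ℝ) {E : Finset (S × S)} (h : ℝ) {f : Config S → ℝ}
    {B : Finset S} (hE : ∀ xy ∈ E, xy.1 ∈ B ∧ xy.2 ∈ B) (hf : DependsOn f (B : Set S)) :
    DependsOn (eulerStep p E h f) (B : Set S) := by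
  intro η ζ hηζ
  simp only [eulerStep, hf hηζ, dependsOn_partialGenerator p hE hf hηζ]

/-- Under the rate condition `h1` an Euler step is an average of `f` over configurations. -/
lemma abs_eulerStep_le {p : S → S → ℝ} (hp : ∀ x y, 0 ≤ p x y) {E : Finset (S × S)} {h : ℝ}
    (h0 : 0 ≤ h) (h1 : h * ∑ xy ∈ E, p xy.1 xy.2 ≤ 1) {f : Config S → ℝ} {C : ℝ}
    (hf : ∀ η, |f η| ≤ C) (η : Config S) : |eulerStep p E h f η| ≤ C := by
  rw [eulerStep_eq]
  calc |(1 - h * ∑ xy ∈ E, p xy.1 xy.2) * f η + h * ∑ xy ∈ E, p xy.1 xy.2 * f (hop η xy.1 xy.2)|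
      ≤ (1 - h * ∑ xy ∈ E, p xy.1 xy.2) * |f η|
        + h * |∑ xy ∈ E, p xy.1 xy.2 * f (hop η xy.1 xy.2)| := by
        refine (abs_add_le _ _).trans_eq ?_
        rw [abs_mul, abs_mul, abs_of_nonneg h0, abs_of_nonneg (sub_nonneg.2 h1)]
    _ ≤ (1 - h * ∑ xy ∈ E, p xy.1 xy.2) * C + h * ∑ xy ∈ E, p xy.1 xy.2 * C := by
        have := sub_nonneg.2 h1
        gcongr
        · exact hf η
        · refine (Finset.abs_sum_le_sum_abs _ _).trans (Finset.sum_le_sum fun xy _ => ?_)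
          rw [abs_mul, abs_of_nonneg (hp _ _)]
          exact mul_le_mul_of_nonneg_left (hf _) (hp _ _)
    _ = C := by rw [← Finset.sum_mul]; ring

open Classical in
/-- `H` dominates, up to the factor `K`, the rate at which jumps carry oscillation to `z`: a jump
between `x` and `y` contributes `p(x, y) (H x + H y)` to its two endpoints. Finite sums over `F`
stand for the full sum, so that no summability is presupposed. -/
def IsSupersolution (p : S → S → ℝ) (K : ℝ) (H : S → ℝ) : Prop :=
  ∀ (z : S) (F : Finset (S × S)),
    ∑ xy ∈ F, (if z = xy.1 ∨ z = xy.2 then p xy.1 xy.2 * (H xy.1 + H xy.2) else 0) ≤ K * H z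

lemma IsSupersolution.const_mul {p : S → S → ℝ} {K : ℝ} {H : S → ℝ} (hH : IsSupersolution p K H)
    {a : ℝ} (ha : 0 ≤ a) : IsSupersolution p K fun z => a * H z := by
  classical
  intro z F
  have := mul_le_mul_of_nonneg_left (hH z F) ha
  rw [Finset.mul_sum] at this
  calc _ = _ := Finset.sum_congr rfl fun xy _ => by split_ifs <;> ring
    _ ≤ _ := this
    _ = _ := by ring

/-- Oscillations grow at most by the factor `1 + h K` in an Euler step, whatever the finite set `E`
of jumps: only `H` and `K` matter, and these depend on `p` alone. -/
lemma HasOscBound.eulerStep {p : S → S → ℝ} (hp : ∀ x y, 0 ≤ p x y) {E : Finset (S × S)} {h : ℝ}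
    (h0 : 0 ≤ h) (h1 : h * ∑ xy ∈ E, p xy.1 xy.2 ≤ 1) {f : Config S → ℝ} {H : S → ℝ} {K : ℝ}
    (hH : IsSupersolution p K H) (hf : HasOscBound f H) :
    HasOscBound (eulerStep p E h f) fun z => (1 + h * K) * H z := by
  classical
  intro η ζ z hηζ
  have hstep : ∀ xy ∈ E, |p xy.1 xy.2 * f (hop ζ xy.1 xy.2) - p xy.1 xy.2 * f (hop η xy.1 xy.2)| ≤
      p xy.1 xy.2 * H z +
        (if z = xy.1 ∨ z = xy.2 then p xy.1 xy.2 * (H xy.1 + H xy.2) else 0) := fun xy _ => by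
    rw [← mul_sub, abs_mul, abs_of_nonneg (hp _ _)]
    split_ifs with hz
    · rw [← mul_add]
      refine mul_le_mul_of_nonneg_left ?_ (hp _ _)
      have := hf.comp_hop_of_mem xy.1 xy.2 hηζ hz
      have h2 := (abs_nonneg _).trans (hf η η z fun _ _ => rfl)
      linarith
    · rw [add_zero]
      rw [not_or] at hz
      exact mul_le_mul_of_nonneg_left (hf.comp_hop xy.1 xy.2 hηζ hz.1 hz.2) (hp _ _)
  have hsum := (Finset.abs_sum_le_sum_abs _ _).trans (Finset.sum_le_sum hstep)
  rw [Finset.sum_add_distrib, Finset.sum_sub_distrib, ← Finset.sum_mul] at hsum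
  have hz := hf η ζ z hηζ
  have hHz := hH z E
  have h1' := sub_nonneg.2 h1
  rw [eulerStep_eq, eulerStep_eq]
  set c := ∑ xy ∈ E, p xy.1 xy.2
  set U := ∑ xy ∈ E, p xy.1 xy.2 * f (hop ζ xy.1 xy.2)
  set V := ∑ xy ∈ E, p xy.1 xy.2 * f (hop η xy.1 xy.2)
  calc |(1 - h * c) * f ζ + h * U - ((1 - h * c) * f η + h * V)|
      = |(1 - h * c) * (f ζ - f η) + h * (U - V)| := by congr 1; ring
    _ ≤ (1 - h * c) * |f ζ - f η| + h * |U - V| := by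
        refine (abs_add_le _ _).trans_eq ?_
        rw [abs_mul, abs_mul, abs_of_nonneg h0, abs_of_nonneg h1']
    _ ≤ (1 - h * c) * H z + h * (c * H z + K * H z) := by
        gcongr
        exact hsum.trans (by gcongr)
    _ = (1 + h * K) * H z := by ring

lemma exists_isSupersolution {p : S → S → ℝ} (hp : IsStochastic p) (hcol : BoundedColumnSums p)
    (A : Finset S) :
    ∃ (H : S → ℝ) (K : ℝ), 0 ≤ K ∧ (∀ z, 0 ≤ H z) ∧ Summable H ∧ (∀ z ∈ A, 1 ≤ H z) ∧
      IsSupersolution p K H := by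
  classical
  obtain ⟨M, hM⟩ := hcol
  have hq : ∀ (y : S) (F : Finset S), ∑ x ∈ F, (p x y + p y x) ≤ M + 1 := fun y F => by
    rw [Finset.sum_add_distrib]
    exact add_le_add (hM y F) (sum_le_hasSum F (fun x _ => hp.1 y x) (hp.2 y))
  obtain ⟨H, K, hK, hH0, hHs, hHA, hHK⟩ := exists_summable_superinvariant (fun x y => p x y + p y x)
    (fun x y => add_nonneg (hp.1 x y) (hp.1 y x)) (M + 1) hq A
  refine ⟨H, |M + 1| + K, by positivity, hH0, hHs, hHA, fun z F => ?_⟩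
  have hw : ∀ x y, 0 ≤ p x y * (H x + H y) := fun x y =>
    mul_nonneg (hp.1 x y) (add_nonneg (hH0 x) (hH0 y))
  let G : Finset S := F.image Prod.fst ∪ F.image Prod.snd
  have hFG : F ⊆ G ×ˢ G := fun xy hxy => by
    simp only [G, Finset.mem_product, Finset.mem_union, Finset.mem_image]
    exact ⟨Or.inl ⟨xy, hxy, rfl⟩, Or.inr ⟨xy, hxy, rfl⟩⟩
  calc ∑ xy ∈ F, (if z = xy.1 ∨ z = xy.2 then p xy.1 xy.2 * (H xy.1 + H xy.2) else 0)
      ≤ ∑ xy ∈ G ×ˢ G, (if z = xy.1 ∨ z = xy.2 then p xy.1 xy.2 * (H xy.1 + H xy.2) else 0) :=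
        Finset.sum_le_sum_of_subset_of_nonneg hFG fun xy _ _ => by
          split_ifs
          · exact hw _ _
          · rfl
    _ ≤ ∑ xy ∈ G ×ˢ G, ((if z = xy.1 then p xy.1 xy.2 * (H xy.1 + H xy.2) else 0) +
          (if z = xy.2 then p xy.1 xy.2 * (H xy.1 + H xy.2) else 0)) := by
        refine Finset.sum_le_sum fun xy _ => ?_
        have := hw xy.1 xy.2
        by_cases h1 : z = xy.1 <;> by_cases h2 : z = xy.2 <;> simp only [h1, h2, true_or, or_true,
          or_self, if_true, if_false] <;> first | linarith | skip
        all_goals split_ifs <;> linarith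
    _ = ∑ y ∈ G, (if z ∈ G then p z y * (H z + H y) else 0) +
          ∑ x ∈ G, (if z ∈ G then p x z * (H x + H z) else 0) := by
        rw [Finset.sum_add_distrib, Finset.sum_product_right, Finset.sum_product]
        simp only [Finset.sum_ite_eq]
    _ ≤ ∑ y ∈ G, p z y * (H z + H y) + ∑ x ∈ G, p x z * (H x + H z) := by
        gcongr <;> split_ifs <;> first | rfl | exact hw _ _
    _ = (∑ x ∈ G, (p x z + p z x)) * H z + ∑ y ∈ G, (p z y + p y z) * H y := by
        rw [Finset.sum_mul, ← Finset.sum_add_distrib, ← Finset.sum_add_distrib]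
        exact Finset.sum_congr rfl fun x _ => by ring
    _ ≤ |M + 1| * H z + K * H z := by
        gcongr
        · exact hH0 z
        · exact (hq z G).trans (le_abs_self _)
        · exact hHK z G
    _ = (|M + 1| + K) * H z := by ring

lemma BoundedColumnSums.summable {p : S → S → ℝ} (hp : ∀ x y, 0 ≤ p x y)
    (hcol : BoundedColumnSums p) (y : S) : Summable fun x => p x y := by
  obtain ⟨M, hM⟩ := hcol
  exact summable_of_sum_le (fun x => hp x y) (hM y)

lemma summable_mul_left_of_isStochastic {p : S → S → ℝ} (hp : IsStochastic p) {H : S → ℝ}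
    (hH0 : ∀ z, 0 ≤ H z) (hH : Summable H) : Summable fun xy : S × S => p xy.1 xy.2 * H xy.1 := by
  have h0 : (0 : S × S → ℝ) ≤ fun xy => p xy.1 xy.2 * H xy.1 :=
    Pi.le_def.2 fun xy => mul_nonneg (hp.1 _ _) (hH0 _)
  rw [summable_prod_of_nonneg h0]
  refine ⟨fun x => (hp.2 x).summable.mul_right (H x), hH.congr fun x => ?_⟩
  dsimp only
  rw [tsum_mul_right, (hp.2 x).tsum_eq, one_mul]

lemma summable_mul_right_of_boundedColumnSums {p : S → S → ℝ} (hp : ∀ x y, 0 ≤ p x y)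
    (hcol : BoundedColumnSums p) {H : S → ℝ}
    (hH0 : ∀ z, 0 ≤ H z) (hH : Summable H) : Summable fun xy : S × S => p xy.1 xy.2 * H xy.2 := by
  have h0 : (0 : S × S → ℝ) ≤ fun yx => p yx.2 yx.1 * H yx.1 :=
    Pi.le_def.2 fun yx => mul_nonneg (hp _ _) (hH0 _)
  have key : Summable fun yx : S × S => p yx.2 yx.1 * H yx.1 := by
    rw [summable_prod_of_nonneg h0]
    refine ⟨fun y => (hcol.summable hp y).mul_right (H y), ?_⟩
    obtain ⟨M, hM⟩ := id hcol
    refine Summable.of_nonneg_of_le (fun y => tsum_nonneg fun x => mul_nonneg (hp _ _) (hH0 _))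
      (fun y => ?_) (hH.mul_left M)
    dsimp only
    rw [tsum_mul_right]
    exact mul_le_mul_of_nonneg_right
      ((hcol.summable hp y).tsum_le_of_sum_le (hM y)) (hH0 y)
  exact (Equiv.prodComm S S).summable_iff.1 key

lemma summable_weight {p : S → S → ℝ} (hp : IsStochastic p)
    (hcol : BoundedColumnSums p) {H : S → ℝ}
    (hH0 : ∀ z, 0 ≤ H z) (hH : Summable H) :
    Summable fun xy : S × S => p xy.1 xy.2 * (H xy.1 + H xy.2) := by
  simpa only [mul_add] using (summable_mul_left_of_isStochastic hp hH0 hH).add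
    (summable_mul_right_of_boundedColumnSums hp.1 hcol hH0 hH)

lemma HasOscBound.abs_term_le {p : S → S → ℝ} (hp : ∀ x y, 0 ≤ p x y) {f : Config S → ℝ}
    {H : S → ℝ} (hf : HasOscBound f H) (η : Config S) (xy : S × S) :
    |p xy.1 xy.2 * (f (hop η xy.1 xy.2) - f η)| ≤ p xy.1 xy.2 * (H xy.1 + H xy.2) := by
  rw [abs_mul, abs_of_nonneg (hp _ _)]
  exact mul_le_mul_of_nonneg_left (hf.abs_hop_sub_le η _ _) (hp _ _)

/-- The error made by dropping the jumps outside `E` is a tail of a convergent series, uniformly in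
the configuration and over all functions with the same oscillation bound. -/
lemma HasOscBound.abs_generator_sub_le {p : S → S → ℝ} (hp : IsStochastic p)
    (hcol : BoundedColumnSums p) {H : S → ℝ} (hH0 : ∀ z, 0 ≤ H z) (hH : Summable H)
    (E : Finset (S × S)) {f : Config S → ℝ} (hf : HasOscBound f H) (η : Config S) :
    |generator p f η - partialGenerator p E f η| ≤
      ∑' xy : {xy : S × S // xy ∉ E}, p xy.1.1 xy.1.2 * (H xy.1.1 + H xy.1.2) := by
  have hw := summable_weight hp hcol hH0 hH
  have hs : Summable fun xy : S × S => p xy.1 xy.2 * (f (hop η xy.1 xy.2) - f η) :=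
    Summable.of_norm_bounded hw fun xy => hf.abs_term_le hp.1 η xy
  rw [generator_eq_tsum_hop, ← hs.sum_add_tsum_subtype_compl E, partialGenerator,
    add_sub_cancel_left]
  exact tsum_of_norm_bounded (f := fun xy : {xy : S × S // xy ∉ E} =>
    p xy.1.1 xy.1.2 * (f (hop η xy.1.1 xy.1.2) - f η)) (hw.subtype _).hasSum
    fun xy => hf.abs_term_le hp.1 η xy

/-! ### Cylinder functions -/

lemma IsCylinder.measurable {f : Config S → ℝ} (hf : IsCylinder f) : Measurable f :=
  measurable_of_dependsOn hf.choose_spec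

lemma IsCylinder.exists_abs_le {f : Config S → ℝ} (hf : IsCylinder f) :
    ∃ C : ℝ, 0 ≤ C ∧ ∀ η, |f η| ≤ C :=
  exists_abs_le_of_dependsOn hf.choose_spec

lemma IsCylinder.integrable {f : Config S → ℝ} (hf : IsCylinder f) (μ : Measure (Config S))
    [IsFiniteMeasure μ] : Integrable f μ :=
  integrable_of_dependsOn hf.choose_spec μ

lemma IsCylinder.exists_hasOscBound {f : Config S → ℝ} (hf : IsCylinder f) :
    ∃ H : S → ℝ, (∀ z, 0 ≤ H z) ∧ Summable H ∧ HasOscBound f H := by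
  classical
  obtain ⟨A, hA⟩ := hf
  obtain ⟨C, hC0, hC⟩ := exists_abs_le_of_dependsOn hA
  refine ⟨fun z => 2 * C * if z ∈ A then 1 else 0, fun z => by positivity, ?_,
    hasOscBound_of_dependsOn hA hC (fun z => by positivity) fun z hz => by simp [hz]⟩
  exact summable_of_ne_finset_zero (s := A) fun z hz => by simp [hz]

lemma abs_integral_le_of_abs_le {X : Type*} [MeasurableSpace X] {μ : Measure X}
    [IsProbabilityMeasure μ] {f : X → ℝ} {C : ℝ} (h : ∀ x, |f x| ≤ C) : |∫ x, f x ∂μ| ≤ C := by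
  simpa using norm_integral_le_of_norm_le_const (μ := μ) (f := f) (C := C) (Eventually.of_forall h)

lemma integral_bind_kernel {X : Type*} [MeasurableSpace X] {κ : Kernel X X} [IsMarkovKernel κ]
    {μ : Measure X} [IsProbabilityMeasure μ] {f : X → ℝ} (hf : Integrable f (μ.bind κ)) :
    ∫ x, f x ∂μ.bind κ = ∫ x, ∫ y, f y ∂κ x ∂μ := by
  have h := Kernel.integral_comp (η := κ) (κ := Kernel.const Unit μ) (a := ()) (f := f)
  rw [Kernel.comp_const, Kernel.const_apply, Kernel.const_apply] at h
  exact h hf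

/-! ### Stationarity in terms of the generator -/

section Semigroup

variable {p : S → S → ℝ} {P : ℝ≥0 → Kernel (Config S) (Config S)}

lemma IsExclusionProcess.measurable_integral (hP : IsExclusionProcess p P) (t : ℝ≥0)
    {f : Config S → ℝ} (hf : Measurable f) : Measurable fun η => ∫ ζ, f ζ ∂P t η := by
  have := hP.markov t
  exact (StronglyMeasurable.integral_kernel (κ := P t) hf.stronglyMeasurable).measurable

lemma IsExclusionProcess.measurable_generator (hP : IsExclusionProcess p P)
    {f : Config S → ℝ} (hf : IsCylinder f) : Measurable (generator p f) :=
  measurable_of_tendsto_metrizable' (𝓝[>] (0 : ℝ≥0))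
    (fun t => ((hP.measurable_integral t hf.measurable).sub hf.measurable).div_const _)
    (tendsto_pi_nhds.2 fun η => (hP.generator_eq f hf).tendsto_at η)

lemma IsExclusionProcess.integrable_generator (hP : IsExclusionProcess p P)
    (hp : IsStochastic p) (hcol : BoundedColumnSums p) {f : Config S → ℝ} (hf : IsCylinder f)
    (μ : Measure (Config S)) [IsFiniteMeasure μ] : Integrable (generator p f) μ := by
  obtain ⟨H, hH0, hHs, hH⟩ := hf.exists_hasOscBound
  exact Integrable.of_bound (hP.measurable_generator hf).aestronglyMeasurable _
    (Eventually.of_forall fun η => by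
      simpa [partialGenerator] using hH.abs_generator_sub_le hp hcol hH0 hHs ∅ η)

/-- The convergence `(P_h g - g) / h → Ω g` is uniform over the bounded functions `g` of the
coordinates in `B`, since these form a finite-dimensional space. -/
lemma IsExclusionProcess.eventually_abs_diffQuotient_sub_generator_le
    (hP : IsExclusionProcess p P) (B : Finset S) (C : ℝ) {δ : ℝ} (hδ : 0 < δ) :
    ∀ᶠ h : ℝ≥0 in 𝓝[>] 0, ∀ g : Config S → ℝ, DependsOn g (B : Set S) → (∀ η, |g η| ≤ C) →
      ∀ η, |((∫ ζ, g ζ ∂P h η) - g η) / (h : ℝ) - generator p g η| ≤ δ := by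
  classical
  let e : (B → Bool) → Config S → ℝ := fun σ η => if σ = (fun i : B => η i) then 1 else 0
  have hedep : ∀ σ, DependsOn (e σ) (B : Set S) := fun σ η ζ h => by
    have : (fun i : B => η i) = fun i : B => ζ i := funext fun i => h i i.2
    simp [e, this]
  have he : ∀ σ, IsCylinder (e σ) := fun σ => ⟨B, hedep σ⟩
  have hdecomp : ∀ g : Config S → ℝ, DependsOn g (B : Set S) →
      ∀ η, g η = ∑ σ, g (fillEmpty B σ) * e σ η := fun g hg η => by
    simp [e, apply_fillEmpty_of_dependsOn hg]
  -- `Q h` is the difference quotient of the semigroup; it is linear on cylinder functions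
  let Q : ℝ≥0 → (Config S → ℝ) → Config S → ℝ :=
    fun h g η => ((∫ ζ, g ζ ∂P h η) - g η) / (h : ℝ)
  have hQ : ∀ (h : ℝ≥0) (g : Config S → ℝ), DependsOn g (B : Set S) →
      ∀ η, Q h g η = ∑ σ, g (fillEmpty B σ) * Q h (e σ) η := fun h g hg η => by
    have := hP.markov h
    simp only [Q]
    rw [integral_congr_ae (Eventually.of_forall (hdecomp g hg)),
      integral_finsetSum _ fun σ _ => ((he σ).integrable _).const_mul _]
    simp only [integral_const_mul]
    conv_lhs => rw [hdecomp g hg η]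
    rw [← Finset.sum_sub_distrib, Finset.sum_div]
    exact Finset.sum_congr rfl fun σ _ => by ring
  -- linearity passes to the limit `h → 0`, which avoids summability issues in `generator`
  have hlim : ∀ (g : Config S → ℝ), DependsOn g (B : Set S) → ∀ η,
      generator p g η = ∑ σ, g (fillEmpty B σ) * generator p (e σ) η := fun g hg η => by
    refine tendsto_nhds_unique ((hP.generator_eq g ⟨B, hg⟩).tendsto_at η) ?_
    refine Tendsto.congr (fun h => (hQ h g hg η).symm) (tendsto_finsetSum _ fun σ _ => ?_)
    exact ((hP.generator_eq _ (he σ)).tendsto_at η).const_mul _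
  let N : ℝ := (Fintype.card (B → Bool) : ℝ) * (|C| + 1)
  have hcard : 0 < (Fintype.card (B → Bool) : ℝ) := by exact_mod_cast Fintype.card_pos
  have hN : 0 < N := by positivity
  have hev : ∀ᶠ h : ℝ≥0 in 𝓝[>] 0, ∀ σ, ∀ η, |Q h (e σ) η - generator p (e σ) η| ≤ δ / N := by
    refine eventually_all.2 fun σ => ?_
    filter_upwards [Metric.tendstoUniformly_iff.1 (hP.generator_eq _ (he σ)) (δ / N) (by positivity)]
      with h hh η
    have := hh η
    rw [dist_comm, Real.dist_eq] at this
    exact this.le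
  filter_upwards [hev] with h hh g hg hgC η
  change |Q h g η - generator p g η| ≤ δ
  rw [hQ h g hg, hlim g hg, ← Finset.sum_sub_distrib]
  calc |∑ σ, (g (fillEmpty B σ) * Q h (e σ) η - g (fillEmpty B σ) * generator p (e σ) η)|
      ≤ ∑ σ : B → Bool, (|C| + 1) * (δ / N) := by
        refine (Finset.abs_sum_le_sum_abs _ _).trans (Finset.sum_le_sum fun σ _ => ?_)
        rw [← mul_sub, abs_mul]
        have h1 := hgC (fillEmpty B σ)
        have h2 := le_abs_self C
        exact mul_le_mul (by linarith) (hh σ η) (abs_nonneg _) (by positivity)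
    _ = δ := by
        simp only [Finset.sum_const, Finset.card_univ, nsmul_eq_mul, N]
        field_simp

/-- One-step errors of the Euler scheme add up, because `P_h` is a contraction. -/
lemma IsExclusionProcess.abs_integral_sub_iterate_le (hP : IsExclusionProcess p P)
    {E : Finset (S × S)} {f : Config S → ℝ} {h : ℝ≥0} {ε : ℝ} {m : ℕ}
    (hcyl : ∀ k, IsCylinder ((eulerStep p E h)^[k] f))
    (hstep : ∀ k < m, ∀ ξ, |(∫ ζ, (eulerStep p E h)^[k] f ζ ∂P h ξ)
      - (eulerStep p E h)^[k + 1] f ξ| ≤ h * ε) (η : Config S) :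
    |(∫ ζ, f ζ ∂P (m * h) η) - (eulerStep p E h)^[m] f η| ≤ m * (h * ε) := by
  have hM := hP.markov
  induction m generalizing η with
  | zero =>
    simp [hP.zero, Kernel.id_apply,
      integral_dirac' f η (hcyl 0).measurable.stronglyMeasurable]
  | succ m ih =>
    have hf := hcyl 0
    obtain ⟨C, -, hC⟩ := hf.exists_abs_le
    have ih := ih fun k hk => hstep k (by omega)
    have h1 : ∫ ζ, f ζ ∂P ((m + 1 : ℕ) * h) η = ∫ ξ, ∫ ζ, f ζ ∂P (m * h) ξ ∂P h η := by
      have : ((m + 1 : ℕ) : ℝ≥0) * h = h + m * h := by push_cast; ring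
      rw [this, hP.chapman_kolmogorov, Kernel.integral_comp]
      exact hf.integrable _
    have h2 : |(∫ ξ, ∫ ζ, f ζ ∂P (m * h) ξ ∂P h η) - ∫ ζ, (eulerStep p E h)^[m] f ζ ∂P h η|
        ≤ m * (h * ε) := by
      rw [← integral_sub _ ((hcyl m).integrable _)]
      · exact abs_integral_le_of_abs_le ih
      · exact Integrable.of_bound (hP.measurable_integral _ hf.measurable).aestronglyMeasurable C
          (Eventually.of_forall fun ξ => abs_integral_le_of_abs_le hC)
    have h3 := hstep m (by omega) η
    rw [h1]
    refine (abs_sub_le _ (∫ ζ, (eulerStep p E h)^[m] f ζ ∂P h η) _).trans ?_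
    push_cast
    linarith

/-- If `ν` annihilates `Ω f` for all cylinder functions `f`, then `ν P_t = ν` on cylinder functions.
Both `P_t f` and the integral of `f` are compared with the Euler scheme of a finite set of jumps,
whose iterates are cylinder functions with oscillations bounded independently of that set. -/
theorem IsExclusionProcess.integral_integral_eq (hP : IsExclusionProcess p P)
    (hp : IsStochastic p) (hcol : BoundedColumnSums p) (ν : Measure (Config S))
    [IsProbabilityMeasure ν] (hν : ∀ f, IsCylinder f → ∫ η, generator p f η ∂ν = 0)
    (t : ℝ≥0) {f : Config S → ℝ} (hf : IsCylinder f) :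
    ∫ η, ∫ ζ, f ζ ∂P t η ∂ν = ∫ η, f η ∂ν := by
  classical
  have hM := hP.markov
  rcases eq_or_ne t 0 with rfl | ht0
  · simp [hP.zero, Kernel.id_apply, integral_dirac' f _ hf.measurable.stronglyMeasurable]
  have ht : 0 < t := pos_iff_ne_zero.2 ht0
  obtain ⟨A, hA⟩ := id hf
  obtain ⟨C, hC0, hC⟩ := hf.exists_abs_le
  obtain ⟨H, K, hK, hH0, hHs, hHA, hHK⟩ := exists_isSupersolution hp hcol A
  have hfH := hasOscBound_of_dependsOn hA hC hH0 hHA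
  let R : ℝ := Real.exp (t * K) * (2 * C)
  have hR : 0 ≤ R := by positivity
  have key : ∀ δ > 0, |(∫ η, ∫ ζ, f ζ ∂P t η ∂ν) - ∫ η, f η ∂ν| ≤ t * (3 * δ) := by
    intro δ hδ
    -- finitely many jumps `E`, chosen before the mesh: `R * H` bounds all later oscillations
    obtain ⟨E, hE⟩ := (((tendsto_tsum_compl_atTop_zero
      fun xy : S × S => p xy.1 xy.2 * (H xy.1 + H xy.2)).const_mul R).eventually
        (ge_mem_nhds (by simpa using hδ : R * 0 < δ))).exists
    let B : Finset S := A ∪ (E.image Prod.fst ∪ E.image Prod.snd)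
    have hEB : ∀ xy ∈ E, xy.1 ∈ B ∧ xy.2 ∈ B := fun xy hxy => by
      simp only [B, Finset.mem_union, Finset.mem_image]
      exact ⟨Or.inr (Or.inl ⟨xy, hxy, rfl⟩), Or.inr (Or.inr ⟨xy, hxy, rfl⟩)⟩
    have hfB : DependsOn f (B : Set S) := fun η ζ h =>
      hA fun x hx => h x (Finset.mem_coe.2 (Finset.mem_union_left _ (Finset.mem_coe.1 hx)))
    -- a mesh `h = t / m` fine enough for all three smallness requirements
    have hrate : ∀ᶠ h : ℝ≥0 in 𝓝[>] 0, (h : ℝ) * ∑ xy ∈ E, p xy.1 xy.2 ≤ 1 := by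
      have : Tendsto (fun h : ℝ≥0 => (h : ℝ) * ∑ xy ∈ E, p xy.1 xy.2) (𝓝 0) (𝓝 0) := by
        simpa using ((NNReal.continuous_coe.tendsto 0).mul_const (∑ xy ∈ E, p xy.1 xy.2))
      exact (this.mono_left nhdsWithin_le_nhds).eventually (ge_mem_nhds one_pos)
    have hmesh : Tendsto (fun m : ℕ => t / (m : ℝ≥0)) atTop (𝓝[>] 0) := by
      refine tendsto_nhdsWithin_iff.2 ⟨tendsto_const_div_atTop_nhds_zero_nat t, ?_⟩
      filter_upwards [eventually_gt_atTop 0] with m hm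
      exact div_pos ht (by exact_mod_cast hm)
    obtain ⟨m, ⟨hc, hgen⟩, hm⟩ := ((hmesh.eventually (hrate.and
      (hP.eventually_abs_diffQuotient_sub_generator_le B C hδ))).and
        (eventually_gt_atTop 0)).exists
    have hm' : (m : ℝ≥0) ≠ 0 := by exact_mod_cast hm.ne'
    set h : ℝ≥0 := t / (m : ℝ≥0)
    have hh : 0 < h := div_pos ht (by exact_mod_cast hm)
    have hh' : (0 : ℝ) < h := hh
    have hmh : (m : ℝ≥0) * h = t := mul_div_cancel₀ _ hm'
    have hmhR : (m : ℝ) * (h : ℝ) = t := by exact_mod_cast congrArg NNReal.toReal hmh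
    let v : ℕ → Config S → ℝ := fun k => (eulerStep p E h)^[k] f
    have hvs : ∀ k, v (k + 1) = eulerStep p E h (v k) := fun k =>
      Function.iterate_succ_apply' _ _ _
    have hvB : ∀ k, DependsOn (v k) (B : Set S) := fun k => by
      induction k with
      | zero => exact hfB
      | succ k ih => rw [hvs]; exact dependsOn_eulerStep p h hEB ih
    have hvcyl : ∀ k, IsCylinder (v k) := fun k => ⟨B, hvB k⟩
    have hvC : ∀ k η, |v k η| ≤ C := fun k => by
      induction k with
      | zero => exact hC
      | succ k ih => rw [hvs]; exact abs_eulerStep_le hp.1 hh'.le hc ih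
    have hvH : ∀ k, HasOscBound (v k) fun z => ((1 + h * K) ^ k * (2 * C)) * H z := fun k => by
      induction k with
      | zero => simpa [v] using hfH
      | succ k ih =>
        rw [hvs]
        have := HasOscBound.eulerStep hp.1 hh'.le hc
          (hHK.const_mul (a := (1 + h * K) ^ k * (2 * C)) (by positivity)) ih
        refine fun η ζ z hz => (this η ζ z hz).trans_eq ?_
        ring
    have hvR : ∀ k ≤ m, HasOscBound (v k) fun z => R * H z := fun k hk η ζ z hz => by
      refine (hvH k η ζ z hz).trans ?_
      refine mul_le_mul_of_nonneg_right (mul_le_mul_of_nonneg_right ?_ (by positivity)) (hH0 z)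
      calc (1 + h * K) ^ k ≤ (1 + h * K) ^ m :=
            pow_le_pow_right₀ (le_add_of_nonneg_right (by positivity)) hk
        _ ≤ Real.exp (h * K) ^ m := by
            gcongr
            rw [add_comm]; exact Real.add_one_le_exp _
        _ = Real.exp (t * K) := by
            rw [← Real.exp_nat_mul, ← hmhR, mul_assoc]
    have hvgen : ∀ k ≤ m, ∀ η, |generator p (v k) η - partialGenerator p E (v k) η| ≤ δ :=
      fun k hk η => by
        refine ((hvR k hk).abs_generator_sub_le hp hcol (fun z => mul_nonneg hR (hH0 z))
          (hHs.mul_left R) E η).trans (le_trans (le_of_eq ?_) hE)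
        rw [← tsum_mul_left]
        exact tsum_congr fun xy => by ring
    have hstep : ∀ k < m, ∀ ξ, |(∫ ζ, v k ζ ∂P h ξ) - v (k + 1) ξ| ≤ h * (2 * δ) :=
      fun k hk ξ => by
        have h1 := hgen (v k) (hvB k) (hvC k) ξ
        have h2 := hvgen k hk.le ξ
        have h3 : (∫ ζ, v k ζ ∂P h ξ) - v (k + 1) ξ =
            h * ((((∫ ζ, v k ζ ∂P h ξ) - v k ξ) / h - generator p (v k) ξ) +
              (generator p (v k) ξ - partialGenerator p E (v k) ξ)) := by
          rw [hvs, eulerStep]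
          field_simp
          ring
        rw [h3, abs_mul, abs_of_pos hh']
        refine mul_le_mul_of_nonneg_left ((abs_add_le _ _).trans ?_) hh'.le
        linarith
    -- the Euler scheme follows the semigroup, and it nearly preserves the integral against `ν`
    have hsemi : ∀ η, |(∫ ζ, f ζ ∂P t η) - v m η| ≤ t * (2 * δ) := fun η => by
      have := hP.abs_integral_sub_iterate_le hvcyl hstep η
      rwa [hmh, ← mul_assoc, hmhR] at this
    have hdrift : ∀ k ≤ m, |(∫ η, v k η ∂ν) - ∫ η, f η ∂ν| ≤ k * (h * δ) := fun k => by
      induction k with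
      | zero => intro _; simp [v]
      | succ k ih =>
        intro hk
        have hL : IsCylinder (partialGenerator p E (v k)) :=
          ⟨B, dependsOn_partialGenerator p hEB (hvB k)⟩
        have h1 : ∫ η, v (k + 1) η ∂ν
            = (∫ η, v k η ∂ν) + h * ∫ η, partialGenerator p E (v k) η ∂ν := by
          rw [hvs]
          simp only [eulerStep]
          rw [integral_add ((hvcyl k).integrable _) ((hL.integrable _).const_mul _),
            integral_const_mul]
        have h2 : |∫ η, partialGenerator p E (v k) η ∂ν| ≤ δ := by
          have h3 : ∫ η, partialGenerator p E (v k) η ∂ν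
              = -∫ η, (generator p (v k) η - partialGenerator p E (v k) η) ∂ν := by
            rw [integral_sub (hP.integrable_generator hp hcol (hvcyl k) ν) (hL.integrable _),
              hν _ (hvcyl k)]
            ring
          rw [h3, abs_neg]
          exact abs_integral_le_of_abs_le (hvgen k (by omega))
        have h4 := ih (by omega)
        have h5 : |(h : ℝ) * ∫ η, partialGenerator p E (v k) η ∂ν| ≤ h * δ := by
          rw [abs_mul, abs_of_pos hh']
          gcongr
        rw [h1, add_sub_right_comm]
        refine (abs_add_le _ _).trans ?_
        push_cast
        linarith
    have h1 := hdrift m le_rfl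
    rw [← mul_assoc, hmhR] at h1
    have h2 : |(∫ η, ∫ ζ, f ζ ∂P t η ∂ν) - ∫ η, v m η ∂ν| ≤ t * (2 * δ) := by
      rw [← integral_sub _ ((hvcyl m).integrable _)]
      · exact abs_integral_le_of_abs_le hsemi
      · exact Integrable.of_bound (hP.measurable_integral _ hf.measurable).aestronglyMeasurable C
          (Eventually.of_forall fun ξ => abs_integral_le_of_abs_le hC)
    refine (abs_sub_le _ (∫ η, v m η ∂ν) _).trans ?_
    linarith
  rw [← sub_eq_zero, ← abs_nonpos_iff]
  refine le_of_forall_pos_le_add fun ε hε => ?_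
  have htR : (0 : ℝ) < t := ht
  refine (key (ε / (3 * t)) (by positivity)).trans_eq ?_
  field_simp
  ring

/-- Cylinder functions suffice to test stationarity. -/
theorem IsExclusionProcess.isStationary_iff (hP : IsExclusionProcess p P)
    (hp : IsStochastic p) (hcol : BoundedColumnSums p) (ν : Measure (Config S))
    [IsProbabilityMeasure ν] :
    IsStationary P ν ↔ ∀ f, IsCylinder f → ∫ η, generator p f η ∂ν = 0 := by
  classical
  have hM := hP.markov
  refine ⟨fun hst f hf => ?_, fun hν t => ?_⟩
  · obtain ⟨C, -, hC⟩ := hf.exists_abs_le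
    have hPint : ∀ t, Integrable (fun η => ∫ ζ, f ζ ∂P t η) ν := fun t =>
      Integrable.of_bound (hP.measurable_integral _ hf.measurable).aestronglyMeasurable C
        (Eventually.of_forall fun ξ => abs_integral_le_of_abs_le hC)
    have hzero : ∀ t : ℝ≥0, ∫ η, ((∫ ζ, f ζ ∂P t η) - f η) / (t : ℝ) ∂ν = 0 := fun t => by
      rw [integral_div, integral_sub (hPint t) (hf.integrable _)]
      have h1 : ∫ η, f η ∂ν = ∫ η, ∫ ζ, f ζ ∂P t η ∂ν := by
        conv_lhs => rw [← (hst t).def]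
        exact integral_bind_kernel (hf.integrable _)
      rw [h1, sub_self, zero_div]
    rw [← abs_nonpos_iff]
    refine le_of_forall_pos_le_add fun ε hε => ?_
    obtain ⟨t, ht⟩ := (Metric.tendstoUniformly_iff.1 (hP.generator_eq f hf) ε hε).exists
    have h2 : ∫ η, generator p f η ∂ν
        = ∫ η, (generator p f η - ((∫ ζ, f ζ ∂P t η) - f η) / (t : ℝ)) ∂ν := by
      rw [integral_sub (g := fun η => ((∫ ζ, f ζ ∂P t η) - f η) / (t : ℝ))
        (hP.integrable_generator hp hcol hf ν) (((hPint t).sub (hf.integrable _)).div_const _),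
        hzero t, sub_zero]
    rw [h2, zero_add]
    exact abs_integral_le_of_abs_le fun η => (Real.dist_eq _ _ ▸ ht η).le
  · refine ext_of_generate_finite _ generateFrom_measurableCylinders.symm
      isPiSystem_measurableCylinders (fun s hs => ?_) (by simp)
    obtain ⟨A, T, hT, rfl⟩ := (mem_measurableCylinders s).1 hs
    have hsm : MeasurableSet (cylinder A T) :=
      MeasurableSet.cylinder (α := fun _ : S => Bool) A hT
    let f : Config S → ℝ := (cylinder A T).indicator 1
    have hf : IsCylinder f := ⟨A, fun η ζ h => by
      have : A.restrict η = A.restrict ζ := funext fun i => h i i.2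
      simp [f, Set.indicator, mem_cylinder, this]⟩
    have h1 := hP.integral_integral_eq hp hcol ν hν t hf
    have h2 : ∫ η, f η ∂(ν.bind (P t)) = ∫ η, ∫ ζ, f ζ ∂P t η ∂ν :=
      integral_bind_kernel (hf.integrable _)
    rw [← h2] at h1
    simp only [f, integral_indicator_one hsm] at h1
    exact (measureReal_eq_measureReal_iff).1 h1

end Semigroup

/-! ### The product measure -/

/-- The occupation number of the site `x`, as a real number. -/
def occ (η : Config S) (x : S) : ℝ := if η x = true then 1 else 0

lemma isProbabilityMeasure_marginal {a : ℝ} (ha : 0 < a ∧ a < 1) : IsProbabilityMeasure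
    (ENNReal.ofReal a • Measure.dirac true + ENNReal.ofReal (1 - a) • Measure.dirac false) := by
  constructor
  simp only [Measure.add_apply, Measure.smul_apply, measure_univ, smul_eq_mul, mul_one]
  rw [← ENNReal.ofReal_add ha.1.le (by linarith [ha.2])]
  simp

lemma integral_marginal {a : ℝ} (ha : 0 < a ∧ a < 1) (φ : Bool → ℝ) :
    ∫ b, φ b ∂(ENNReal.ofReal a • Measure.dirac true + ENNReal.ofReal (1 - a) • Measure.dirac false)
      = a * φ true + (1 - a) * φ false := by
  rw [integral_add_measure, integral_smul_measure, integral_smul_measure, integral_dirac,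
    integral_dirac, ENNReal.toReal_ofReal ha.1.le, ENNReal.toReal_ofReal (by linarith [ha.2])]
  · simp
  · exact (integrable_dirac (by simp)).smul_measure ENNReal.ofReal_ne_top
  · exact (integrable_dirac (by simp)).smul_measure ENNReal.ofReal_ne_top

section Product

variable {α : S → ℝ}

lemma isProbabilityMeasure_productMeasure (hα : ∀ x, 0 < α x ∧ α x < 1) :
    IsProbabilityMeasure (productMeasure α) := by
  have := fun x => isProbabilityMeasure_marginal (hα x)
  unfold productMeasure
  infer_instance

/-- Under the product measure, a function of the other sites is independent of the site `x`. -/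
lemma integral_site_mul (hα : ∀ x, 0 < α x ∧ α x < 1) {A : Finset S} {f : Config S → ℝ}
    (hf : DependsOn f (A : Set S)) {x : S} (hx : x ∉ A) (φ : Bool → ℝ) :
    ∫ η, φ (η x) * f η ∂productMeasure α =
      (α x * φ true + (1 - α x) * φ false) * ∫ η, f η ∂productMeasure α := by
  classical
  have := fun x => isProbabilityMeasure_marginal (hα x)
  have hind : iIndepFun (fun (i : S) (η : Config S) => η i) (productMeasure α) :=
    iIndepFun_infinitePi (X := fun _ b => b) fun _ => measurable_id
  have h1 := hind.indepFun_finset {x} A (by simpa using hx) fun i => measurable_pi_apply i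
  have h2 : (fun η : Config S => φ (η x)) ⟂ᵢ[productMeasure α] f := by
    have h3 := h1.comp (φ := fun s : (({x} : Finset S) → Bool) => φ (s ⟨x, by simp⟩))
      (ψ := fun s => f (fillEmpty A s)) (measurable_of_countable _) (measurable_of_countable _)
    have h4 : (fun s => f (fillEmpty A s)) ∘ (fun (η : Config S) (i : A) => η i) = f :=
      funext fun η => apply_fillEmpty_of_dependsOn hf η
    rw [h4] at h3
    exact h3
  rw [h2.integral_fun_mul_eq_mul_integral
    ((measurable_of_countable φ).comp (measurable_pi_apply x)).aestronglyMeasurable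
    (measurable_of_dependsOn hf).aestronglyMeasurable]
  congr 1
  rw [← integral_marginal (hα x), ← Measure.infinitePi_map_eval (fun x =>
    ENNReal.ofReal (α x) • Measure.dirac true + ENNReal.ofReal (1 - α x) • Measure.dirac false) x,
    integral_map (measurable_pi_apply x).aemeasurable
      (measurable_of_countable φ).aestronglyMeasurable]
  rfl

lemma integral_occ_mul (hα : ∀ x, 0 < α x ∧ α x < 1) {A : Finset S} {g : Config S → ℝ}
    (hg : DependsOn g (A : Set S)) {x y : S} (hx : x ∉ A) (hy : y ∉ A) (hxy : x ≠ y) :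
    ∫ η, occ η x * (1 - occ η y) * g η ∂productMeasure α =
      α x * (1 - α y) * ∫ η, g η ∂productMeasure α := by
  classical
  have h1 : DependsOn (fun η : Config S => (1 - occ η y) * g η)
      ((insert y A : Finset S) : Set S) := fun η ζ h => by
    have h2 : g η = g ζ := hg fun z hz => h z (by simp [Finset.mem_coe.1 hz])
    simp only [h2, occ, h y (by simp)]
  have h2 := integral_site_mul hα h1 (x := x) (by simp [hxy, hx]) fun b => if b = true then 1 else 0
  have h3 := integral_site_mul hα hg hy fun b => 1 - if b = true then 1 else 0
  simp only [← mul_assoc] at h2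
  simp only [occ] at h2 h3 ⊢
  rw [h2, h3]
  simp [mul_assoc]

lemma integral_occ_sub_mul (hα : ∀ x, 0 < α x ∧ α x < 1) {A : Finset S} {g : Config S → ℝ}
    (hg : DependsOn g (A : Set S)) {x : S} (hx : x ∉ A) :
    ∫ η, (occ η x - α x) * g η ∂productMeasure α = 0 := by
  have := integral_site_mul hα hg hx fun b => (if b = true then 1 else 0) - α x
  simp only [occ]
  rw [this]
  simp
  left
  ring

/-! ### The mean of the generator -/

lemma move_source (η : Config S) {x y : S} (h : x ≠ y) : move η x y x = false := by
  simp [move, h]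

lemma move_target (η : Config S) (x y : S) : move η x y y = true := by
  simp [move]

lemma move_eq_self {η : Config S} {x y : S} (hx : η x = false) (hy : η y = true) :
    move η x y = η := by
  funext w
  by_cases hwy : w = y
  · rw [hwy, move_target, hy]
  by_cases hwx : w = x
  · subst hwx; rw [move_source η hwy, hx]
  · exact move_apply_of_ne η hwx hwy

open Classical in
lemma dependsOn_comp_move {f : Config S → ℝ} {A : Finset S} (hf : DependsOn f (A : Set S))
    (x y : S) : DependsOn (fun η => f (move η x y)) (((A.erase x).erase y : Finset S) : Set S) := by
  intro η ζ h
  refine hf fun w hw => ?_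
  by_cases hwy : w = y
  · rw [hwy, move_target, move_target]
  by_cases hwx : w = x
  · subst hwx; rw [move_source η hwy, move_source ζ hwy]
  · exact move_congr x y (h w (by simpa [hwx, hwy] using hw))

/-- The mean difference between the values of `f` with a particle at `y` and a hole at `x`, and the
other way round, all other sites being distributed according to the product measure. -/
noncomputable def exchange (α : S → ℝ) (f : Config S → ℝ) (x y : S) : ℝ :=
  ∫ η, (f (move η x y) - f (move η y x)) ∂productMeasure α

lemma exchange_swap (f : Config S → ℝ) (x y : S) : exchange α f y x = -exchange α f x y := by
  unfold exchange
  rw [← integral_neg]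
  simp

lemma exchange_self (f : Config S → ℝ) (x : S) : exchange α f x x = 0 := by
  simp [exchange]

/-- On the event that the jump is allowed, `η` is itself of the form `move η y x`. -/
lemma apply_hop_sub (f : Config S → ℝ) (η : Config S) (x y : S) :
    f (hop η x y) - f η = occ η x * (1 - occ η y) * (f (move η x y) - f (move η y x)) := by
  unfold hop occ
  cases hx : η x <;> cases hy : η y <;> simp
  rw [move_eq_self hy hx]

lemma integral_apply_hop_sub (hα : ∀ x, 0 < α x ∧ α x < 1) {f : Config S → ℝ}
    (hf : IsCylinder f) (x y : S) :
    ∫ η, (f (hop η x y) - f η) ∂productMeasure α = α x * (1 - α y) * exchange α f x y := by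
  classical
  obtain ⟨A, hA⟩ := hf
  simp only [apply_hop_sub]
  rcases eq_or_ne x y with rfl | hxy
  · simp [exchange]
  have hg : DependsOn (fun η => f (move η x y) - f (move η y x))
      (((A.erase x).erase y : Finset S) : Set S) := fun η ζ h => by
    have h1 := dependsOn_comp_move hA x y h
    have h2 := dependsOn_comp_move hA y x
    rw [Finset.erase_right_comm] at h2
    have h2 := h2 h
    simp only at h1 h2 ⊢
    rw [h1, h2]
  exact integral_occ_mul hα hg (by simp) (by simp) hxy

/-- The covariance of `f` and the occupation number of the site `x`. It vanishes if `f` does not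
depend on `x`. -/
noncomputable def siteCovariance (α : S → ℝ) (f : Config S → ℝ) (x : S) : ℝ :=
  ∫ η, (occ η x - α x) * f η ∂productMeasure α

/-- Between sites of equal density, the exchange term is a discrete gradient. -/
lemma siteCovariance_sub (hα : ∀ x, 0 < α x ∧ α x < 1) {f : Config S → ℝ} (hf : IsCylinder f)
    {x y : S} (hxy : α x = α y) :
    siteCovariance α f y - siteCovariance α f x = α x * (1 - α y) * exchange α f x y := by
  classical
  have := isProbabilityMeasure_productMeasure hα
  rcases eq_or_ne x y with rfl | hne
  · simp [exchange_self]
  obtain ⟨A, hA⟩ := id hf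
  have hcyl : ∀ z, IsCylinder fun η => (occ η z - α z) * f η := fun z =>
    ⟨insert z A, fun η ζ h => by
      have h1 : f η = f ζ := hA fun w hw => h w (by simp [Finset.mem_coe.1 hw])
      simp only [h1, occ, h z (by simp)]⟩
  have hswap : ∀ {x y : S}, x ≠ y →
      Integrable (fun η => occ η x * (1 - occ η y) * f (move η y x)) (productMeasure α) ∧
      ∫ η, occ η x * (1 - occ η y) * f (move η y x) ∂productMeasure α =
      α x * (1 - α y) * ∫ η, f (move η y x) ∂productMeasure α := fun {x y} hne => by
    have h := dependsOn_comp_move hA y x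
    refine ⟨IsCylinder.integrable ⟨insert x (insert y A), fun η ζ h' => ?_⟩ _,
      integral_occ_mul hα h (by simp) (by simp) hne⟩
    have h1 := h (x := η) (y := ζ) fun w hw => h' w (by
      simp only [Finset.coe_erase, Set.mem_sdiff] at hw
      simp [Finset.mem_coe.1 hw.1.1])
    simp only at h1
    simp only [h1, occ, h' x (by simp), h' y (by simp)]
  have hmove : ∀ x y, Integrable (fun η => f (move η x y)) (productMeasure α) := fun x y =>
    integrable_of_dependsOn (dependsOn_comp_move hA x y) _
  have hpt : ∀ η : Config S, (occ η y - α y) * f η - (occ η x - α x) * f η =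
      occ η y * (1 - occ η x) * f (move η x y) - occ η x * (1 - occ η y) * f (move η y x) :=
    fun η => by
      rw [hxy]
      unfold occ
      cases hx : η x <;> cases hy : η y <;> simp
      · rw [move_eq_self hx hy]; ring
      · rw [move_eq_self hy hx]; ring
  unfold siteCovariance exchange
  rw [← integral_sub ((hcyl y).integrable _) ((hcyl x).integrable _)]
  simp only [hpt]
  rw [integral_sub (hswap hne.symm).1 (hswap hne).1, (hswap hne.symm).2, (hswap hne).2,
    integral_sub (hmove x y) (hmove y x), hxy]
  ring

/-- The mean of `Ω f` is the sum over all pairs of sites of a rate times an antisymmetric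
factor. -/
lemma hasSum_integral_generator [Countable S] {p : S → S → ℝ} (hp : IsStochastic p)
    (hcol : BoundedColumnSums p) (hα : ∀ x, 0 < α x ∧ α x < 1) {f : Config S → ℝ}
    (hf : IsCylinder f) :
    HasSum (fun xy : S × S => p xy.1 xy.2 * (α xy.1 * (1 - α xy.2)) * exchange α f xy.1 xy.2)
      (∫ η, generator p f η ∂productMeasure α) := by
  classical
  have := isProbabilityMeasure_productMeasure hα
  obtain ⟨H, hH0, hHs, hH⟩ := hf.exists_hasOscBound
  have hcyl : ∀ xy : S × S, IsCylinder fun η => p xy.1 xy.2 * (f (hop η xy.1 xy.2) - f η) :=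
    fun xy => by
      obtain ⟨A, hA⟩ := hf
      have hB : DependsOn f ((insert xy.1 (insert xy.2 A) : Finset S) : Set S) := fun η ζ h =>
        hA fun x hx => h x (by simp [Finset.mem_coe.1 hx])
      refine ⟨insert xy.1 (insert xy.2 A), fun η ζ h => ?_⟩
      simpa [partialGenerator] using
        dependsOn_partialGenerator p (E := {xy}) (by simp) hB h
  have hsum : Summable fun xy : S × S =>
      ∫ η, ‖p xy.1 xy.2 * (f (hop η xy.1 xy.2) - f η)‖ ∂productMeasure α :=
    Summable.of_nonneg_of_le (fun xy => integral_nonneg fun η => norm_nonneg _)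
      (fun xy => (le_abs_self _).trans (abs_integral_le_of_abs_le fun η => by
        rw [Real.norm_eq_abs, abs_abs]
        exact hH.abs_term_le hp.1 η xy)) (summable_weight hp hcol hH0 hHs)
  have h := hasSum_integral_of_summable_integral_norm
    (fun xy => (hcyl xy).integrable (productMeasure α)) hsum
  simp only [integral_const_mul, integral_apply_hop_sub hα hf, ← generator_eq_tsum_hop] at h
  simpa only [mul_assoc] using h

/-! ### Necessity -/

open Classical in
lemma occ_move_sub (η : Config S) (x y u : S) :
    occ (move η x y) u - occ (move η y x) u
      = (if y = u then 1 else 0) - (if x = u then 1 else 0) := by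
  rcases eq_or_ne x y with rfl | hxy
  · simp
  by_cases hy : y = u
  · subst hy
    simp [occ, move_target, move_source η hxy.symm, hxy]
  by_cases hx : x = u
  · subst hx
    simp [occ, move_target, move_source η hxy, hy]
  · simp [occ, move_apply_of_ne η (Ne.symm hx) (Ne.symm hy),
      move_apply_of_ne η (Ne.symm hy) (Ne.symm hx), hx, hy]

lemma occ_move_of_ne (η : Config S) {x y u : S} (hx : u ≠ x) (hy : u ≠ y) :
    occ (move η x y) u = occ η u := by
  simp [occ, move_apply_of_ne η hx hy]

lemma isCylinder_occ (u : S) : IsCylinder fun η => occ η u :=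
  ⟨{u}, fun η ζ h => by simp [occ, h u (by simp)]⟩

/-- The product of the centred occupation numbers at `u` and `v`. -/
noncomputable def covariate (α : S → ℝ) (u v : S) (η : Config S) : ℝ :=
  (occ η u - α u) * (occ η v - α v)

lemma isCylinder_covariate (u v : S) : IsCylinder (covariate α u v) := by
  classical
  refine ⟨{u, v}, fun η ζ h => ?_⟩
  simp [covariate, occ, h u (by simp), h v (by simp)]

/-- An exchange not touching `u` leaves the centred factor at `u`, which has mean zero. -/
lemma exchange_covariate_eq_zero (hα : ∀ x, 0 < α x ∧ α x < 1) {u v x y : S}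
    (h : u ≠ x ∧ u ≠ y) : exchange α (covariate α u v) x y = 0 := by
  classical
  have h1 : ∀ η : Config S, covariate α u v (move η x y) - covariate α u v (move η y x) =
      (occ η u - α u) * ((if y = v then 1 else 0) - (if x = v then 1 else 0)) := fun η => by
    rw [← occ_move_sub η x y v, covariate, covariate, occ_move_of_ne η h.1 h.2,
      occ_move_of_ne η h.2 h.1]
    ring
  simp only [exchange, h1]
  exact integral_occ_sub_mul hα (A := ∅) (fun _ _ _ => rfl) (by simp)

lemma covariate_comm (u v : S) : covariate α u v = covariate α v u := by
  funext η; simp [covariate, mul_comm]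

lemma exchange_covariate (hα : ∀ x, 0 < α x ∧ α x < 1) {u v : S} (huv : u ≠ v) :
    exchange α (covariate α u v) u v = α v - α u := by
  have := isProbabilityMeasure_productMeasure hα
  have h1 : ∀ η : Config S, covariate α u v (move η u v) - covariate α u v (move η v u)
      = α v - α u := fun η => by
    simp only [covariate, occ, move_target, move_source η huv, move_source η huv.symm]
    simp only [Bool.false_eq_true, if_true, if_false]
    ring
  simp [exchange, h1]

lemma summable_mul_of_abs_le_one {ι : Type*} {q w : ι → ℝ} (hq : ∀ i, 0 ≤ q i)
    (hs : Summable q) (hw : ∀ i, |w i| ≤ 1) : Summable fun i => q i * w i :=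
  Summable.of_norm_bounded hs fun i => by
    rw [norm_mul, Real.norm_eq_abs, Real.norm_eq_abs, abs_of_nonneg (hq i)]
    exact mul_le_of_le_one_right (hq i) (hw i)

lemma abs_mul_one_sub_le_one {a b : ℝ} (ha : 0 < a ∧ a < 1) (hb : 0 < b ∧ b < 1) :
    |a * (1 - b)| ≤ 1 := by
  rw [abs_of_nonneg (mul_nonneg ha.1.le (by linarith [hb.2]))]
  nlinarith [ha.1, ha.2, hb.1, hb.2]

lemma tsum_levelSet (a : ℝ) (g : S → ℝ) [DecidablePred fun x => α x = a] :
    ∑' y : levelSet α a, g y = ∑' y, if α y = a then g y else 0 := by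
  rw [tsum_subtype]
  exact tsum_congr fun y => by by_cases h : α y = a <;> simp [levelSet, h]

variable [Countable S] {p : S → S → ℝ}

/-- Testing with the product of the centred occupation numbers at `u` and `v` leaves only the jumps
between `u` and `v` and gives `(c(u, v) - c(v, u)) (α v - α u) = 0`, where
`c(x, y) = p(x, y) α(x) (1 - α(y))`. -/
lemma detailedBalance_of_integral_eq_zero (hp : IsStochastic p)
    (hcol : BoundedColumnSums p) (hα : ∀ x, 0 < α x ∧ α x < 1)
    (h : ∀ f, IsCylinder f → ∫ η, generator p f η ∂productMeasure α = 0) {u v : S}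
    (huv : α u ≠ α v) : p u v * (α u * (1 - α v)) = p v u * (α v * (1 - α u)) := by
  classical
  have hne : u ≠ v := fun e => huv (congrArg α e)
  have h1 := hasSum_integral_generator hp hcol hα (isCylinder_covariate (α := α) u v)
  rw [h _ (isCylinder_covariate u v)] at h1
  have h2 := hasSum_sum_of_ne_finset_zero (L := SummationFilter.unconditional _)
    (s := {(u, v), (v, u)}) (f := fun xy : S × S =>
    p xy.1 xy.2 * (α xy.1 * (1 - α xy.2)) * exchange α (covariate α u v) xy.1 xy.2) <| by
      rintro ⟨x, y⟩ hxy
      simp only [Finset.mem_insert, Finset.mem_singleton, Prod.mk.injEq, not_or, not_and] at hxy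
      have : exchange α (covariate α u v) x y = 0 := by
        rcases eq_or_ne x y with rfl | hne'
        · exact exchange_self _ _
        by_cases hu : u ≠ x ∧ u ≠ y
        · exact exchange_covariate_eq_zero hα hu
        by_cases hv : v ≠ x ∧ v ≠ y
        · rw [covariate_comm]; exact exchange_covariate_eq_zero hα hv
        · exfalso
          grind
      simp [this]
  have h3 := h1.unique h2
  rw [Finset.sum_pair (by simp [hne])] at h3
  simp only [exchange_swap (α := α) _ u v, exchange_covariate hα hne] at h3
  have h4 : (p u v * (α u * (1 - α v)) - p v u * (α v * (1 - α u))) * (α v - α u) = 0 := by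
    linarith
  rcases mul_eq_zero.1 h4 with h5 | h5
  · linarith
  · exact absurd (by linarith) huv

/-- Testing with the occupation number at `u`: the mean current into `u` equals the one out of
`u`. -/
lemma hasSum_current_of_integral_eq_zero (hp : IsStochastic p)
    (hcol : BoundedColumnSums p) (hα : ∀ x, 0 < α x ∧ α x < 1)
    (h : ∀ f, IsCylinder f → ∫ η, generator p f η ∂productMeasure α = 0) (u : S) :
    HasSum (fun x => p x u * (α x * (1 - α u)) - p u x * (α u * (1 - α x))) 0 := by
  classical
  have := isProbabilityMeasure_productMeasure hα
  have h1 := hasSum_integral_generator hp hcol hα (isCylinder_occ u)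
  rw [h _ (isCylinder_occ u)] at h1
  simp only [exchange, occ_move_sub, integral_const, probReal_univ, one_smul] at h1
  have hin : Summable fun x => p x u * (α x * (1 - α u)) :=
    summable_mul_of_abs_le_one (fun x => hp.1 x u) (hcol.summable hp.1 u)
      fun x => abs_mul_one_sub_le_one (hα x) (hα u)
  have hout : Summable fun x => p u x * (α u * (1 - α x)) :=
    summable_mul_of_abs_le_one (fun x => hp.1 u x) (hp.2 u).summable
      fun x => abs_mul_one_sub_le_one (hα u) (hα x)
  have h2 : HasSum (fun xy : S × S => p xy.1 xy.2 * (α xy.1 * (1 - α xy.2)) *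
      (if xy.2 = u then 1 else 0)) (∑' x, p x u * (α x * (1 - α u))) := by
    have hinj : Function.Injective fun x : S => (x, u) := fun x y e => congrArg Prod.fst e
    refine (hinj.hasSum_iff ?_).1 (by simpa [Function.comp_def] using hin.hasSum)
    rintro ⟨x, y⟩ hxy
    have : y ≠ u := fun e => hxy ⟨x, by simp [e]⟩
    simp [this]
  have h3 : HasSum (fun xy : S × S => p xy.1 xy.2 * (α xy.1 * (1 - α xy.2)) *
      (if xy.1 = u then 1 else 0)) (∑' x, p u x * (α u * (1 - α x))) := by
    have hinj : Function.Injective fun x : S => (u, x) := fun x y e => congrArg Prod.snd e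
    refine (hinj.hasSum_iff ?_).1 (by simpa [Function.comp_def] using hout.hasSum)
    rintro ⟨x, y⟩ hxy
    have : x ≠ u := fun e => hxy ⟨y, by simp [e]⟩
    simp [this]
  have h23 := h2.sub h3
  simp only [← mul_sub (_ * _)] at h23
  have h4 := h1.unique h23
  rw [h4]
  exact hin.hasSum.sub hout.hasSum

open Classical in
/-- By detailed balance between different densities, only the sites with the density of `u` remain
in the balance of currents at `u`. -/
lemma levelBalance_of_integral_eq_zero (hp : IsStochastic p)
    (hcol : BoundedColumnSums p) (hα : ∀ x, 0 < α x ∧ α x < 1)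
    (h : ∀ f, IsCylinder f → ∫ η, generator p f η ∂productMeasure α = 0) (u : S) :
    ∑' x, (if α x = α u then p u x else 0) = ∑' x, (if α x = α u then p x u else 0) := by
  have h1 := hasSum_current_of_integral_eq_zero hp hcol hα h u
  have hin : Summable fun x => if α x = α u then p x u else 0 :=
    Summable.of_nonneg_of_le (fun x => by split_ifs <;> first | exact hp.1 _ _ | rfl)
      (fun x => by split_ifs <;> first | rfl | exact hp.1 _ _) (hcol.summable hp.1 u)
  have hout : Summable fun x => if α x = α u then p u x else 0 :=
    Summable.of_nonneg_of_le (fun x => by split_ifs <;> first | exact hp.1 _ _ | rfl)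
      (fun x => by split_ifs <;> first | rfl | exact hp.1 _ _) (hp.2 u).summable
  have h2 := (hin.hasSum.sub hout.hasSum).mul_left (α u * (1 - α u))
  have h3 : (fun x => p x u * (α x * (1 - α u)) - p u x * (α u * (1 - α x))) = fun x =>
      α u * (1 - α u) * ((if α x = α u then p x u else 0) - if α x = α u then p u x else 0) := by
    funext x
    split_ifs with hx
    · rw [hx]; ring
    · rw [detailedBalance_of_integral_eq_zero hp hcol hα h hx]; ring
  rw [h3] at h1
  have h4 := h1.unique h2
  have h5 : 0 < α u * (1 - α u) := mul_pos (hα u).1 (by linarith [(hα u).2])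
  have h6 := (mul_eq_zero.1 h4.symm).resolve_left h5.ne'
  linarith

/-! ### Sufficiency -/

open Classical in
/-- Pairs of equal density contribute `∑ p(x, y) (e(y) - e(x))` with `e` of finite support, which
vanishes as `p` has equal row and column sums within a level set; pairs of different density cancel
with the reversed pairs. -/
theorem integral_generator_eq_zero (hp : IsStochastic p) (hcol : BoundedColumnSums p)
    (hα : ∀ x, 0 < α x ∧ α x < 1)
    (hlevel : ∀ u, ∑' x, (if α x = α u then p u x else 0) = ∑' x, if α x = α u then p x u else 0)
    (hdb : ∀ u v, α u ≠ α v → p u v * (α u * (1 - α v)) = p v u * (α v * (1 - α u)))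
    {f : Config S → ℝ} (hf : IsCylinder f) : ∫ η, generator p f η ∂productMeasure α = 0 := by
  have hsum := hasSum_integral_generator hp hcol hα hf
  let e := siteCovariance α f
  have hesum : Summable fun x => |e x| := by
    obtain ⟨A, hA⟩ := hf
    refine summable_of_ne_finset_zero (s := A) fun x hx => ?_
    simp [e, siteCovariance, integral_occ_sub_mul hα hA hx]
  -- `s` is the kernel `p` restricted to pairs of equal density; its gradient part sums to zero
  let s : S → S → ℝ := fun x y => if α y = α x then p x y else 0
  have hs : ∀ x y, |s x y| ≤ p x y := fun x y => by
    simp only [s]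
    split_ifs
    · exact (abs_of_nonneg (hp.1 x y)).le
    · simpa using hp.1 x y
  have hsl : Summable fun xy : S × S => s xy.1 xy.2 * e xy.1 :=
    Summable.of_norm_bounded (summable_mul_left_of_isStochastic hp (fun z => abs_nonneg (e z)) hesum)
      fun xy => by
        rw [norm_mul, Real.norm_eq_abs, Real.norm_eq_abs]
        exact mul_le_mul_of_nonneg_right (hs _ _) (abs_nonneg _)
  have hsr : Summable fun xy : S × S => s xy.1 xy.2 * e xy.2 :=
    Summable.of_norm_bounded (summable_mul_right_of_boundedColumnSums hp.1 hcol
      (fun z => abs_nonneg (e z)) hesum) fun xy => by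
        rw [norm_mul, Real.norm_eq_abs, Real.norm_eq_abs]
        exact mul_le_mul_of_nonneg_right (hs _ _) (abs_nonneg _)
  have hsr' : Summable fun yx : S × S => s yx.2 yx.1 * e yx.1 :=
    (Equiv.prodComm S S).summable_iff.2 hsr
  have hsame : ∑' xy : S × S, s xy.1 xy.2 * e xy.2 = ∑' xy : S × S, s xy.1 xy.2 * e xy.1 := by
    rw [← (Equiv.prodComm S S).tsum_eq fun xy : S × S => s xy.1 xy.2 * e xy.2]
    change ∑' yx : S × S, s yx.2 yx.1 * e yx.1 = _
    rw [hsr'.tsum_prod, hsl.tsum_prod]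
    refine tsum_congr fun u => ?_
    simp only [tsum_mul_right]
    congr 1
    rw [hlevel u]
    exact tsum_congr fun x => by simp only [s, eq_comm]
  let d : S × S → ℝ := fun xy =>
    p xy.1 xy.2 * (α xy.1 * (1 - α xy.2)) * exchange α f xy.1 xy.2
      - (s xy.1 xy.2 * e xy.2 - s xy.1 xy.2 * e xy.1)
  have hd : HasSum d (∫ η, generator p f η ∂productMeasure α) := by
    have := hsum.sub (hsr.hasSum.sub hsl.hasSum)
    rwa [hsame, sub_self, sub_zero] at this
  -- Equal densities: `d` vanishes. Different densities: the rates are symmetric by detailed balance.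
  have hanti : ∀ xy : S × S, d xy.swap = -d xy := by
    rintro ⟨x, y⟩
    simp only [d, s, Prod.swap, exchange_swap (α := α) f x y]
    by_cases hxy : α x = α y
    · have h1 := siteCovariance_sub hα hf hxy
      have h2 : α y * (1 - α x) = α x * (1 - α y) := by rw [hxy]
      simp only [hxy, if_true, e] at h1 h2 ⊢
      linear_combination (p y x - p x y) * h1
    · rw [if_neg hxy, if_neg (Ne.symm hxy), hdb x y hxy]
      ring
  have hd' : HasSum (fun xy => -d xy) (∫ η, generator p f η ∂productMeasure α) := by
    have := (Equiv.prodComm S S).hasSum_iff.2 hd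
    rwa [show d ∘ Equiv.prodComm S S = fun xy => -d xy from funext hanti] at this
  have := hd.neg.unique hd'
  linarith

end Product

end Exclusion

theorem theorem1 {S : Type*} [Countable S] (p : S → S → ℝ)
    (hp : Exclusion.IsStochastic p) (hcol : Exclusion.BoundedColumnSums p)
    (P : ℝ≥0 → Kernel (Exclusion.Config S) (Exclusion.Config S))
    (hP : Exclusion.IsExclusionProcess p P)
    (α : S → ℝ) (hα : ∀ x, 0 < α x ∧ α x < 1) :
    Exclusion.IsStationary P (Exclusion.productMeasure α) ↔
      (∀ a ∈ Set.range α, ∀ x ∈ Exclusion.levelSet α a,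
        ∑' y : Exclusion.levelSet α a, p x y = ∑' y : Exclusion.levelSet α a, p y x) ∧
      (∀ a ∈ Set.range α, ∀ b ∈ Set.range α, a ≠ b →
        ∀ x ∈ Exclusion.levelSet α a, ∀ y ∈ Exclusion.levelSet α b,
          a / (1 - a) * p x y = b / (1 - b) * p y x) := by
  classical
  have := Exclusion.isProbabilityMeasure_productMeasure hα
  have hodds : ∀ x y, (α x / (1 - α x) * p x y = α y / (1 - α y) * p y x ↔
      p x y * (α x * (1 - α y)) = p y x * (α y * (1 - α x))) := fun x y => by
    have hx : 1 - α x ≠ 0 := by linarith [(hα x).2]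
    have hy : 1 - α y ≠ 0 := by linarith [(hα y).2]
    rw [div_mul_eq_mul_div, div_mul_eq_mul_div, div_eq_div_iff hx hy]
    constructor <;> intro h <;> linarith
  rw [hP.isStationary_iff hp hcol]
  constructor
  · refine fun h => ⟨?_, ?_⟩
    · rintro a - x rfl
      rw [Exclusion.tsum_levelSet _ fun y => p x y, Exclusion.tsum_levelSet _ fun y => p y x]
      exact Exclusion.levelBalance_of_integral_eq_zero hp hcol hα h x
    · rintro a - b - hab x rfl y rfl
      exact (hodds x y).2 (Exclusion.detailedBalance_of_integral_eq_zero hp hcol hα h hab)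
  · rintro ⟨ha, hb⟩ f hf
    refine Exclusion.integral_generator_eq_zero hp hcol hα (fun u => ?_) (fun u v huv => ?_) hf
    · have := ha (α u) ⟨u, rfl⟩ u rfl
      rwa [Exclusion.tsum_levelSet _ fun y => p u y, Exclusion.tsum_levelSet _ fun y => p y u] at this
    · exact (hodds u v).1 (hb _ ⟨u, rfl⟩ _ ⟨v, rfl⟩ huv u rfl v rfl)
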